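/- For $N\ge 1$ and $\theta\in[0,1]$, the alternating-wells random walk is the discrete-time Markov chain on $\mathcal X_N=[-2N,2N]\cap\mathbb Z$, started at $0$, with the following transition probabilities. From $x\in[-N,N]\cap\mathbb Z$ it jumps to $x+1$ with probability $1-\theta$ and to $x-1$ with probability $\theta$; from $x\in([-2N+1,-N-1]\cup[N+1,2N-1])\cap\mathbb Z$ it jumps to $x+1$ with probability $\theta$ and to $x-1$ with probability $1-\theta$. The transition probabilities from the two states $\pm 2N$ are arbitrary. Let $\mathbb P_{0,\delta_\theta}$ and $\mathbb E_{0,\delta_\theta}$ denote the law of this chain and the corresponding expectation, and let $\tau_N$ be the first time the chain hits $\{-2N,2N\}$. Theorem. For every $\theta\in(0,1)\setminus\{1/2\}$ the hitting time $\tau_N$ is $\mathbb P_{0,\delta_\theta}$-almost surely finite with $\mathbb E_{0,\delta_\theta}[\tau_N]<\infty$ for every $N\ge1$, and $$\frac{\tau_N}{\mathbb E_{0,\delta_\theta}[\tau_N]}\;\underset{N\to\infty}{\longrightarrow}\;\mathrm{Exp}(1)\qquad\text{in distribution under }\mathbb P_{0,\delta_\theta};$$ that is, every such $\theta$ is metastable.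 -/

import Mathlib

open MeasureTheory ProbabilityTheory Filter Topology
open scoped ENNReal NNReal

noncomputable section

/-! ### Finite Markov chains on path space -/

/-- The one-step transition kernel of a row-stochastic matrix `Q` on a finite state space:
from `x`, the next state is `y` with probability `Q x y`. -/
def Markov.stepKernel {S : Type*} [Fintype S] [DecidableEq S] [MeasurableSpace S]
    [MeasurableSingletonClass S] (Q : Matrix.rowStochastic ℝ S) : Kernel S S :=
  Kernel.ofFunOfCountable fun x => ∑ y, ENNReal.ofReal (Q.1 x y) • Measure.dirac y

instance Markov.isMarkovKernel_stepKernel {S : Type*} [Fintype S] [DecidableEq S]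
    [MeasurableSpace S] [MeasurableSingletonClass S] (Q : Matrix.rowStochastic ℝ S) :
    IsMarkovKernel (Markov.stepKernel Q) := by
  refine ⟨fun x => ⟨?_⟩⟩
  have h := Matrix.mem_rowStochastic.1 Q.2
  have h1 : ∑ y, Q.1 x y = 1 := by
    have := congrFun h.2 x
    simpa [Matrix.mulVec, dotProduct] using this
  simp only [Markov.stepKernel, Kernel.ofFunOfCountable, Kernel.coe_mk, Measure.coe_finsetSum,
    Finset.sum_apply, Measure.smul_apply, measure_univ, smul_eq_mul, mul_one]
  rw [← ENNReal.ofReal_sum_of_nonneg fun y _ => h.1 x y, h1, ENNReal.ofReal_one]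

/-- The law, on the space of paths `ℕ → S`, of the time-homogeneous Markov chain with transition
matrix `Q` started at `x₀`: given the past up to time `n`, the state at time `n + 1` is drawn
from the row of `Q` indexed by the state at time `n`. -/
def Markov.chainLaw {S : Type*} [Fintype S] [DecidableEq S] [MeasurableSpace S]
    [MeasurableSingletonClass S] (Q : Matrix.rowStochastic ℝ S) (x₀ : S) : Measure (ℕ → S) :=
  Kernel.trajMeasure (X := fun _ => S) (Measure.dirac x₀) fun n =>
    (Markov.stepKernel Q).comap (fun h : (Finset.Iic n) → S => h ⟨n, Finset.mem_Iic.2 le_rfl⟩)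
      (measurable_pi_apply _)

instance Markov.isProbabilityMeasure_chainLaw {S : Type*} [Fintype S] [DecidableEq S]
    [MeasurableSpace S] [MeasurableSingletonClass S] (Q : Matrix.rowStochastic ℝ S) (x₀ : S) :
    IsProbabilityMeasure (Markov.chainLaw Q x₀) := by
  unfold Markov.chainLaw
  infer_instance

/-! ### The alternating-wells random walk -/

namespace AltWells

/-- The state space `[-2N, 2N] ∩ ℤ`. -/
abbrev State (N : ℕ) : Type := Set.Icc (-(2 * N : ℤ)) (2 * N : ℤ)

/-- The starting point `0`. -/
def origin (N : ℕ) : State N := ⟨0, by constructor <;> omega⟩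

/-- The target set `{-2N, 2N}`. -/
def target (N : ℕ) : Set (State N) := {x | (x : ℤ) = -(2 * N) ∨ (x : ℤ) = 2 * N}

open Classical in
/-- The entries of the transition matrix of the alternating-wells random walk. Off the target, the
walk moves by `±1`: on `[-N, N]` it goes right with probability `1 - θ` and left with probability
`θ`; on `[-2N + 1, -N - 1] ∪ [N + 1, 2N - 1]` it goes right with probability `θ` and left with
probability `1 - θ`. The rows of the two target states are those of `B`. -/
def entry (N : ℕ) (θ : ℝ) (B : Matrix (State N) (State N) ℝ) : Matrix (State N) (State N) ℝ :=
  fun x y =>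
    if x ∈ target N then B x y
    else if |(x : ℤ)| ≤ N then
      if (y : ℤ) = x + 1 then 1 - θ else if (y : ℤ) = x - 1 then θ else 0
    else
      if (y : ℤ) = x + 1 then θ else if (y : ℤ) = x - 1 then 1 - θ else 0

theorem sum_step {N : ℕ} {x : State N} (hx : x ∉ target N) (p q : ℝ) :
    ∑ y : State N, (if (y : ℤ) = x + 1 then p else if (y : ℤ) = x - 1 then q else 0) = p + q := by
  have hx2 := x.2
  simp only [target, Set.mem_ofPred_eq, not_or] at hx
  rw [Set.mem_Icc] at hx2
  let r : State N := ⟨x + 1, by constructor <;> omega⟩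
  let l : State N := ⟨x - 1, by constructor <;> omega⟩
  have hrl : r ≠ l := by
    intro h
    have := congrArg (fun z : State N => (z : ℤ)) h
    simp only [r, l] at this
    omega
  have : ∀ y : State N, (if (y : ℤ) = x + 1 then p else if (y : ℤ) = x - 1 then q else 0)
      = (if y = r then p else 0) + (if y = l then q else 0) := by
    intro y
    have h1 : y = r ↔ (y : ℤ) = x + 1 := Subtype.ext_iff
    have h2 : y = l ↔ (y : ℤ) = x - 1 := Subtype.ext_iff
    simp only [h1, h2]
    split_ifs <;> first | omega | simp
  simp [this, Finset.sum_add_distrib]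

/-- The transition matrix of the alternating-wells random walk, as a row-stochastic matrix. The
rows of the two target states are arbitrary: they are those of the stochastic matrix `B`. -/
def Q (N : ℕ) (θ : unitInterval) (B : Matrix.rowStochastic ℝ (State N)) :
    Matrix.rowStochastic ℝ (State N) :=
  ⟨entry N θ B.1, by
    have hB := Matrix.mem_rowStochastic.1 B.2
    have h0 := θ.2.1
    have h1 := θ.2.2
    refine Matrix.mem_rowStochastic.2 ⟨fun x y => ?_, funext fun x => ?_⟩
    · unfold entry
      split_ifs <;> first | exact hB.1 x y | linarith
    · simp only [Matrix.mulVec, dotProduct, Pi.one_apply, mul_one]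
      by_cases hx : x ∈ target N
      · have := congrFun hB.2 x
        simpa [Matrix.mulVec, dotProduct, entry, hx] using this
      · by_cases hN : |(x : ℤ)| ≤ N
        · simp only [entry, hx, hN, if_true, if_false]
          rw [sum_step hx]
          ring
        · simp only [entry, hx, hN, if_false]
          rw [sum_step hx]
          ring⟩

/-- The law `ℙ_{0,δ_θ}` of the alternating-wells random walk started at `0`. -/
def law (N : ℕ) (θ : unitInterval) (B : Matrix.rowStochastic ℝ (State N)) :
    Measure (ℕ → State N) :=
  Markov.chainLaw (Q N θ B) (origin N)

instance (N : ℕ) (θ : unitInterval) (B : Matrix.rowStochastic ℝ (State N)) :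
    IsProbabilityMeasure (law N θ B) :=
  Markov.isProbabilityMeasure_chainLaw _ _

/-- The first time `τ_N` at which a path hits `{-2N, 2N}` (`⊤` if it never does). -/
def τ (N : ℕ) (ω : ℕ → State N) : ℕ∞ :=
  hittingAfter (fun n (ω : ℕ → State N) => ω n) (target N) 0 ω

/-- The mean hitting time `𝔼_{0,δ_θ}[τ_N]`. -/
def mean (N : ℕ) (θ : unitInterval) (B : Matrix.rowStochastic ℝ (State N)) : ℝ≥0∞ :=
  ∫⁻ ω, (τ N ω : ℝ≥0∞) ∂(law N θ B)

end AltWells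

/-- The exponential distribution of rate one is a probability measure. -/
instance isProbabilityMeasure_expMeasure_one : IsProbabilityMeasure (expMeasure 1) :=
  isProbabilityMeasure_expMeasure one_pos

end

/-!
Let `h` be the mean hitting time as a function of the starting point and `m` its value at the
starting point of the chain. The killed expectations `a n = 𝔼[h (X n); n < τ]` satisfy
`a n - a (n + 1) = ℙ(n < τ)`, because `h` loses one unit per step on average. If `h (X n)` stays
close to `m` until `τ`, then `a n ≈ m (a n - a (n + 1))`, hence `a n ≈ m (1 - 1 / m) ^ n`, and the
tail `ℙ(n < τ)`, being antitone and the difference of `a`, is close to `exp (-t)` at `n ≈ t m`.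
The total error `∑ n, 𝔼[|h (X n) - m|; n < τ]` is at most `W x₀` for every `W ≥ 0` with
`|h - m| + P W ≤ W`, so it is enough that `W x₀ / m ^ 2` tends to `0`.

For the alternating wells with `θ < 1 / 2` the walk is trapped around `N`. Comparison with
exponential potentials shows that `h N` grows exponentially, and that `|h - h 0|` is at most
`K V + K + O(N)`, where `K = h N / ρ ^ N` and `V` is the power `ρ ^ wellDist`. As `V`
decreases by a fixed factor on average away from `N`, this yields a `W` with
`W 0 = O(h N + (K + N) h 0)`, while `h 0` is of order `h N`. The case `θ > 1 / 2` follows by the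
reflection `x ↦ -x`.
-/

section GeometricTail

theorem tendsto_one_sub_inv_pow_floor {t : ℝ} (ht : 0 ≤ t) :
    Tendsto (fun y : ℝ => (1 - 1 / y) ^ ⌊t * y⌋₊) atTop (𝓝 (Real.exp (-t))) := by
  have h_log := (tendsto_nat_floor_mul_div_atTop ht).mul
    (Real.tendsto_mul_log_one_add_div_atTop (-1))
  rw [mul_neg_one] at h_log
  refine ((Real.continuous_exp.tendsto _).comp h_log).congr' ?_
  filter_upwards [eventually_gt_atTop 1] with y hy
  have h_pos : 0 < 1 - 1 / y := sub_pos.2 ((div_lt_one (by linarith)).2 hy)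
  rw [Function.comp_apply, ← mul_assoc, div_mul_cancel₀ _ (by linarith : y ≠ 0), neg_div,
    ← sub_eq_add_neg, Real.exp_nat_mul, Real.exp_log h_pos]

theorem abs_sub_mul_one_sub_inv_pow_le {a : ℕ → ℝ} {m C : ℝ} (hm : 1 ≤ m) (h_zero : a 0 = m)
    (hC : ∀ n, ∑ k ∈ Finset.range n, |a k - m * (a k - a (k + 1))| ≤ C) (n : ℕ) :
    |a n - m * (1 - 1 / m) ^ n| ≤ C / m := by
  have hm0 : 0 < m := one_pos.trans_le hm
  have hq0 : 0 ≤ 1 - 1 / m := sub_nonneg.2 ((div_le_one hm0).2 hm)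
  have hq1 : 1 - 1 / m ≤ 1 := sub_le_self _ (by positivity)
  have h_sum : |a n - m * (1 - 1 / m) ^ n| ≤
      (∑ k ∈ Finset.range n, |a k - m * (a k - a (k + 1))|) / m := by
    induction n with
    | zero => simp [h_zero]
    | succ n ih =>
      have h_rec : a (n + 1) - m * (1 - 1 / m) ^ (n + 1) =
          (1 - 1 / m) * (a n - m * (1 - 1 / m) ^ n) + (a n - m * (a n - a (n + 1))) / m := by
        rw [pow_succ]
        generalize (1 - 1 / m) ^ n = r
        field_simp
        ring
      rw [h_rec, Finset.sum_range_succ, add_div]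
      refine (abs_add_le _ _).trans (add_le_add ?_ ?_)
      · rw [abs_mul, abs_of_nonneg hq0]
        exact (mul_le_of_le_one_left (abs_nonneg _) hq1).trans ih
      · rw [abs_div, abs_of_pos hm0]
  exact h_sum.trans (div_le_div_of_nonneg_right (hC n) hm0.le)

theorem sub_mem_Icc_of_antitone {a : ℕ → ℝ} (ha : Antitone fun n => a n - a (n + 1)) {j k : ℕ}
    (hjk : j ≤ k) : a j - a k ∈ Set.Icc (((k : ℝ) - j) * (a k - a (k + 1)))
      (((k : ℝ) - j) * (a j - a (j + 1))) := by
  have h_telescope : ∑ i ∈ Finset.Ico j k, (a i - a (i + 1)) = a j - a k := by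
    rw [Finset.sum_Ico_eq_sub _ hjk, Finset.sum_range_sub', Finset.sum_range_sub']
    ring
  rw [← h_telescope, ← Nat.cast_sub hjk, ← Nat.card_Ico, ← nsmul_eq_mul, ← nsmul_eq_mul]
  exact ⟨Finset.card_nsmul_le_sum _ _ _ fun i hi => ha (Finset.mem_Ico.1 hi).2.le,
    Finset.sum_le_card_nsmul _ _ _ fun i hi => ha (Finset.mem_Ico.1 hi).1⟩

variable {ι : Type*} {l : Filter ι} {a : ι → ℕ → ℝ} {m C : ι → ℝ}

theorem tendsto_floor_div_of_sum_abs_le (hm : Tendsto m l atTop) (h_zero : ∀ i, a i 0 = m i)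
    (hC : ∀ i n, ∑ k ∈ Finset.range n, |a i k - m i * (a i k - a i (k + 1))| ≤ C i)
    (hCm : Tendsto (fun i => C i / m i ^ 2) l (𝓝 0)) {t : ℝ} (ht : 0 ≤ t) :
    Tendsto (fun i => a i ⌊t * m i⌋₊ / m i) l (𝓝 (Real.exp (-t))) := by
  refine tendsto_of_tendsto_of_dist ((tendsto_one_sub_inv_pow_floor ht).comp hm)
    (squeeze_zero' (.of_forall fun _ => dist_nonneg) ?_ hCm)
  filter_upwards [hm.eventually_ge_atTop 1] with i hi
  have hm0 : 0 < m i := one_pos.trans_le hi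
  have h_div : a i ⌊t * m i⌋₊ / m i - (1 - 1 / m i) ^ ⌊t * m i⌋₊ =
      (a i ⌊t * m i⌋₊ - m i * (1 - 1 / m i) ^ ⌊t * m i⌋₊) / m i := by
    field_simp
  rw [Function.comp_apply, dist_comm, Real.dist_eq, h_div, abs_div, abs_of_pos hm0, sq, ← div_div]
  exact div_le_div_of_nonneg_right
    (abs_sub_mul_one_sub_inv_pow_le hi (h_zero i) (hC i) _) hm0.le

theorem tendsto_floor_secant (hm : Tendsto m l atTop)
    (ha : ∀ t, 0 ≤ t → Tendsto (fun i => a i ⌊t * m i⌋₊ / m i) l (𝓝 (Real.exp (-t)))) {t u : ℝ}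
    (ht : 0 ≤ t) (htu : t < u) :
    Tendsto (fun i => (a i ⌊t * m i⌋₊ - a i ⌊u * m i⌋₊) / ((⌊u * m i⌋₊ : ℝ) - ⌊t * m i⌋₊)) l
      (𝓝 ((Real.exp (-t) - Real.exp (-u)) / (u - t))) := by
  have hu : 0 ≤ u := ht.trans htu.le
  have h_floor {v : ℝ} (hv : 0 ≤ v) : Tendsto (fun i => (⌊v * m i⌋₊ : ℝ) / m i) l (𝓝 v) :=
    (tendsto_nat_floor_mul_div_atTop hv).comp hm
  refine (((ha t ht).sub (ha u hu)).div ((h_floor hu).sub (h_floor ht))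
    (sub_pos.2 htu).ne').congr' ?_
  filter_upwards [hm.eventually_gt_atTop 0] with i hi
  rw [Pi.div_apply, ← sub_div, ← sub_div, div_div_div_cancel_right₀ hi.ne']

theorem eventually_floor_lt_floor (hm : Tendsto m l atTop) {t u : ℝ} (ht : 0 ≤ t) (htu : t < u) :
    ∀ᶠ i in l, ⌊t * m i⌋₊ < ⌊u * m i⌋₊ := by
  have h_gap : Tendsto (fun i => (u - t) * m i) l atTop :=
    hm.const_mul_atTop (sub_pos.2 htu)
  filter_upwards [hm.eventually_ge_atTop 0, h_gap.eventually_ge_atTop 1] with i hi hi1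
  rw [← Nat.add_one_le_iff, ← Nat.floor_add_one (mul_nonneg ht hi)]
  exact Nat.floor_mono (by linarith)

theorem tendsto_secant_exp_neg (t : ℝ) :
    Tendsto (fun u => (Real.exp (-t) - Real.exp (-u)) / (u - t)) (𝓝[≠] t)
      (𝓝 (Real.exp (-t))) := by
  have h_deriv : HasDerivAt (fun u => -Real.exp (-u)) (Real.exp (-t)) t := by
    simpa using! (hasDerivAt_neg t).exp.neg
  refine (hasDerivAt_iff_tendsto_slope.1 h_deriv).congr fun u => ?_
  rw [slope_def_field]
  ring

theorem tendsto_floor_sub_succ (hm : Tendsto m l atTop)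
    (ha : ∀ t, 0 ≤ t → Tendsto (fun i => a i ⌊t * m i⌋₊ / m i) l (𝓝 (Real.exp (-t))))
    (h_anti : ∀ i, Antitone fun n => a i n - a i (n + 1)) {t : ℝ} (ht : 0 < t) :
    Tendsto (fun i => a i ⌊t * m i⌋₊ - a i (⌊t * m i⌋₊ + 1)) l (𝓝 (Real.exp (-t))) := by
  refine tendsto_order.2 ⟨fun c hc => ?_, fun c hc => ?_⟩
  · obtain ⟨u, hcu, htu⟩ := (((tendsto_secant_exp_neg t).mono_left
      (nhdsGT_le_nhdsNE t)).eventually_const_lt hc |>.and self_mem_nhdsWithin).exists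
    filter_upwards [(tendsto_floor_secant hm ha ht.le htu).eventually_const_lt hcu,
      eventually_floor_lt_floor hm ht.le htu] with i hi h_lt
    refine hi.trans_le ((div_le_iff₀' (sub_pos.2 (Nat.cast_lt.2 h_lt))).2 ?_)
    exact (sub_mem_Icc_of_antitone (h_anti i) h_lt.le).2
  · obtain ⟨u, hcu, hu, hut⟩ := (((tendsto_secant_exp_neg t).mono_left
      (nhdsLT_le_nhdsNE t)).eventually_lt_const hc |>.and (Ioo_mem_nhdsLT ht)).exists
    rw [← neg_div_neg_eq, neg_sub, neg_sub] at hcu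
    filter_upwards [(tendsto_floor_secant hm ha hu.le hut).eventually_lt_const hcu,
      eventually_floor_lt_floor hm hu.le hut] with i hi h_lt
    refine lt_of_le_of_lt ((le_div_iff₀' (sub_pos.2 (Nat.cast_lt.2 h_lt))).2 ?_) hi
    exact (sub_mem_Icc_of_antitone (h_anti i) h_lt.le).1

end GeometricTail

section ConvergenceInDistribution

theorem measureReal_Ioc_eq_cdf_sub (μ : Measure ℝ) [IsProbabilityMeasure μ] {a b : ℝ}
    (hab : a ≤ b) : μ.real (Set.Ioc a b) = cdf μ b - cdf μ a := by
  rw [cdf_eq_real, cdf_eq_real, ← Set.Iic_sdiff_Iic,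
    measureReal_sdiff (Set.Iic_subset_Iic.2 hab) measurableSet_Iic]

theorem tendsto_probabilityMeasure_of_tendsto_cdf {ι : Type*} {l : Filter ι}
    [l.IsCountablyGenerated] {μ : ι → ProbabilityMeasure ℝ} {ν : ProbabilityMeasure ℝ}
    {D : Set ℝ} (hD : Dense D)
    (h : ∀ x ∈ D, Tendsto (fun i => cdf (μ i : Measure ℝ) x) l (𝓝 (cdf (ν : Measure ℝ) x))) :
    Tendsto μ l (𝓝 ν) := by
  refine (isPiSystem_Ioc_mem D D).tendsto_probabilityMeasure_of_tendsto_of_mem ?_ ?_ ?_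
  · rintro _ ⟨a, -, b, -, -, rfl⟩
    exact measurableSet_Ioc
  · intro u hu x hx
    obtain ⟨ε, hε, h_ball⟩ := Metric.isOpen_iff.1 hu x hx
    obtain ⟨a, haD, hxa, hax⟩ := hD.exists_between (sub_lt_self x hε)
    obtain ⟨b, hbD, hxb, hbx⟩ := hD.exists_between (lt_add_of_pos_right x hε)
    refine ⟨Set.Ioc a b, ⟨a, haD, b, hbD, hax.trans hxb, rfl⟩, Ioc_mem_nhds hax hxb, ?_⟩
    refine Set.Subset.trans (fun y hy => ?_) h_ball
    rw [Real.ball_eq_Ioo]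
    exact ⟨hxa.trans hy.1, hy.2.trans_lt hbx⟩
  · rintro _ ⟨a, ha, b, hb, hab, rfl⟩
    rw [← NNReal.tendsto_coe]
    simp_rw [← ProbabilityMeasure.measureReal_eq_coe_coeFn, measureReal_Ioc_eq_cdf_sub _ hab.le]
    exact (h b hb).sub (h a ha)

theorem cdf_map_toNat_div {Ω : Type*} [MeasurableSpace Ω] {μ : Measure Ω} [IsProbabilityMeasure μ]
    {σ : Ω → ℕ∞} (hσ : Measurable σ) (h_fin : ∀ᵐ ω ∂μ, σ ω ≠ ⊤) {m x : ℝ} (hm : 0 < m)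
    (hx : 0 ≤ x) :
    cdf (μ.map fun ω => ((σ ω).toNat : ℝ) / m) x =
      1 - μ.real {ω | (⌊x * m⌋₊ : ℕ∞) < σ ω} := by
  have h_meas : Measurable fun ω => ((σ ω).toNat : ℝ) / m :=
    (Measurable.of_discrete (f := fun k : ℕ∞ => (k.toNat : ℝ) / m)).comp hσ
  have : IsProbabilityMeasure (μ.map fun ω => ((σ ω).toNat : ℝ) / m) :=
    Measure.isProbabilityMeasure_map h_meas.aemeasurable
  rw [cdf_eq_real, map_measureReal_apply h_meas measurableSet_Iic,
    ← probReal_compl_eq_one_sub (s := {ω | (⌊x * m⌋₊ : ℕ∞) < σ ω})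
      (hσ (.of_discrete (s := Set.Ioi (⌊x * m⌋₊ : ℕ∞))))]
  refine measureReal_congr (eventuallyEq_set.2 ?_)
  filter_upwards [h_fin] with ω hω
  obtain ⟨k, hk⟩ := ENat.ne_top_iff_exists.1 hω
  simp [← hk, div_le_iff₀ hm, Nat.le_floor_iff (mul_nonneg hx hm.le)]

theorem cdf_map_eq_zero_of_neg {Ω : Type*} [MeasurableSpace Ω] {μ : Measure Ω}
    [IsProbabilityMeasure μ] {X : Ω → ℝ} (hX : Measurable X) (hX0 : ∀ ω, 0 ≤ X ω) {x : ℝ}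
    (hx : x < 0) :
    cdf (μ.map X) x = 0 := by
  have : IsProbabilityMeasure (μ.map X) := Measure.isProbabilityMeasure_map hX.aemeasurable
  have h_empty : X ⁻¹' Set.Iic x = ∅ :=
    Set.eq_empty_of_forall_notMem fun ω => (hx.trans_le (hX0 ω)).not_ge
  rw [cdf_eq_real, map_measureReal_apply hX measurableSet_Iic, h_empty, measureReal_empty]

theorem tendstoInDistribution_expMeasure_one {ι : Type*} {l : Filter ι} [l.IsCountablyGenerated]
    {Ω : ι → Type*} [∀ i, MeasurableSpace (Ω i)] {μ : ∀ i, Measure (Ω i)}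
    [∀ i, IsProbabilityMeasure (μ i)] {σ : ∀ i, Ω i → ℕ∞} {m : ι → ℝ}
    (hσ : ∀ i, Measurable (σ i)) (h_fin : ∀ i, ∀ᵐ ω ∂μ i, σ i ω ≠ ⊤) (hm : Tendsto m l atTop)
    (h_tail : ∀ t, 0 < t → Tendsto (fun i => (μ i).real {ω | (⌊t * m i⌋₊ : ℕ∞) < σ i ω}) l
      (𝓝 (Real.exp (-t)))) :
    TendstoInDistribution (fun i ω => ((σ i ω).toNat : ℝ) / m i) l (id : ℝ → ℝ) μ
      (expMeasure 1) := by
  have h_meas (i : ι) : Measurable fun ω => ((σ i ω).toNat : ℝ) / m i :=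
    (Measurable.of_discrete (f := fun k : ℕ∞ => (k.toNat : ℝ) / m i)).comp (hσ i)
  refine ⟨fun i => (h_meas i).aemeasurable, aemeasurable_id,
    tendsto_probabilityMeasure_of_tendsto_cdf (dense_compl_singleton 0) fun x hx => ?_⟩
  simp only [ProbabilityMeasure.coe_mk, Measure.map_id]
  rw [cdf_expMeasure_eq one_pos, one_mul]
  rcases lt_or_gt_of_ne hx with hx | hx
  · rw [if_neg hx.not_ge]
    refine tendsto_const_nhds.congr' ?_
    filter_upwards [hm.eventually_ge_atTop 0] with i hi
    exact (cdf_map_eq_zero_of_neg (h_meas i) (fun ω => div_nonneg (Nat.cast_nonneg _) hi) hx).symm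
  · rw [if_pos hx.le]
    refine ((h_tail x hx).const_sub 1).congr' ?_
    filter_upwards [hm.eventually_gt_atTop 0] with i hi
    exact (cdf_map_toNat_div (hσ i) (h_fin i) hi hx.le).symm

end ConvergenceInDistribution

section WaitingTime

variable {Ω : Type*} [MeasurableSpace Ω] {μ : Measure Ω} {σ : Ω → ℕ∞}

theorem toENNReal_eq_tsum_lt (k : ℕ∞) : (k : ℝ≥0∞) = ∑' n : ℕ, if (n : ℕ∞) < k then 1 else 0 := by
  induction k using ENat.recTopCoe with
  | top => simp
  | coe k =>
    rw [tsum_eq_sum (s := Finset.range k) (by simp)]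
    simp [Finset.filter_true_of_mem]

theorem lintegral_toENNReal_eq_tsum (hσ : Measurable σ) :
    ∫⁻ ω, (σ ω : ℝ≥0∞) ∂μ = ∑' n : ℕ, μ {ω | (n : ℕ∞) < σ ω} := by
  have h_meas (n : ℕ) : MeasurableSet {ω | (n : ℕ∞) < σ ω} :=
    hσ (.of_discrete (s := Set.Ioi (n : ℕ∞)))
  simp_rw [toENNReal_eq_tsum_lt]
  rw [lintegral_tsum fun n =>
    (Measurable.ite (h_meas n) measurable_const measurable_const).aemeasurable]
  refine tsum_congr fun n => ?_
  rw [← lintegral_indicator_one (h_meas n)]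
  simp only [Set.indicator_apply, Set.mem_ofPred_eq, Pi.one_apply]

theorem ae_ne_top_of_lintegral_toENNReal_ne_top (hσ : Measurable σ)
    (h : ∫⁻ ω, (σ ω : ℝ≥0∞) ∂μ ≠ ⊤) : ∀ᵐ ω ∂μ, σ ω ≠ ⊤ := by
  filter_upwards [ae_lt_top (Measurable.of_discrete.comp hσ) h] with ω hω h_top
  simp [h_top] at hω

end WaitingTime

namespace Markov

section HittingTime

variable {S : Type*} {T : Set S}

/-- The first time at which the path `ω` is in `T` (`⊤` if it never is). -/
noncomputable def hittingTime (T : Set S) : (ℕ → S) → ℕ∞ :=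
  hittingAfter (fun n (ω : ℕ → S) => ω n) T 0

theorem lt_hittingTime_iff {ω : ℕ → S} {n : ℕ} :
    (n : ℕ∞) < hittingTime T ω ↔ ∀ i ≤ n, ω i ∉ T := by
  rw [← not_le]
  refine (not_congr hittingAfter_le_iff).trans ?_
  simp

theorem antitone_setOf_lt_hittingTime (T : Set S) :
    Antitone fun n : ℕ => {ω | (n : ℕ∞) < hittingTime T ω} :=
  fun _ _ hjk _ hω =>
    lt_hittingTime_iff.2 fun i hi => lt_hittingTime_iff.1 hω i (hi.trans hjk)

theorem setOf_lt_hittingTime_eq_preimage (T : Set S) (n : ℕ) :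
    {ω | (n : ℕ∞) < hittingTime T ω} =
      Preorder.frestrictLe (π := fun _ => S) n ⁻¹' {z | ∀ i, z i ∉ T} := by
  ext ω
  simp [lt_hittingTime_iff, Preorder.frestrictLe]

theorem measurable_hittingTime [MeasurableSpace S] (hT : MeasurableSet T) :
    Measurable (hittingTime T) := by
  have : BorelSpace ℕ∞ := ⟨borel_eq_top_of_countable.symm⟩
  refine measurable_of_Ioi fun k => ?_
  induction k using ENat.recTopCoe with
  | top => simp
  | coe n =>
    have h : hittingTime T ⁻¹' Set.Ioi n = ⋂ i ∈ Set.Iic n, (fun ω : ℕ → S => ω i) ⁻¹' Tᶜ := by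
      ext ω
      simp [lt_hittingTime_iff]
    rw [h]
    exact .biInter (Set.to_countable _) fun i _ => measurable_pi_apply i hT.compl

theorem measurableSet_lt_hittingTime [MeasurableSpace S] (hT : MeasurableSet T) (n : ℕ) :
    MeasurableSet {ω | (n : ℕ∞) < hittingTime T ω} :=
  measurable_hittingTime hT (.of_discrete (s := Set.Ioi (n : ℕ∞)))

end HittingTime

section MarkovProperty

variable {S : Type*} [Fintype S] [DecidableEq S] [MeasurableSpace S] [MeasurableSingletonClass S]
  (Q : Matrix.rowStochastic ℝ S) (x₀ : S)

theorem ae_chainLaw_zero : ∀ᵐ ω ∂chainLaw Q x₀, ω 0 = x₀ := by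
  have h_map : (chainLaw Q x₀).map (Preorder.frestrictLe 0) =
      (Measure.dirac x₀).map (MeasurableEquiv.piUnique (fun _ : Finset.Iic 0 => S)).symm := by
    unfold chainLaw Kernel.trajMeasure
    rw [Measure.map_comp _ _ (by fun_prop), Kernel.traj_map_frestrictLe, Kernel.partialTraj_self,
      Measure.id_comp]
  have h_ae : ∀ᵐ z ∂(chainLaw Q x₀).map (Preorder.frestrictLe 0),
      z ⟨0, Finset.mem_Iic.2 le_rfl⟩ = x₀ := by
    rw [h_map, ae_map_iff (MeasurableEquiv.measurable _).aemeasurable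
      (Set.toFinite _).measurableSet]
    exact (ae_dirac_iff (measurableSet_singleton x₀)).2 rfl
  exact ae_of_ae_map (by fun_prop) h_ae

theorem integral_stepKernel (F : S → ℝ) (x : S) :
    ∫ y, F y ∂stepKernel Q x = Q.1.mulVec F x := by
  have hQ := (Matrix.mem_rowStochastic.1 Q.2).1
  simp only [stepKernel, Kernel.ofFunOfCountable, Kernel.coe_mk, Matrix.mulVec, dotProduct]
  rw [integral_finsetSum_measure fun y _ => (integrable_dirac (by simp)).smul_measure (by simp)]
  simp [hQ x]

theorem setIntegral_chainLaw_succ (F : S → ℝ) (n : ℕ) (A : Set (Finset.Iic n → S)) :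
    ∫ ω in Preorder.frestrictLe n ⁻¹' A, F (ω (n + 1)) ∂chainLaw Q x₀ =
      ∫ ω in Preorder.frestrictLe n ⁻¹' A, Q.1.mulVec F (ω n) ∂chainLaw Q x₀ := by
  have hA : MeasurableSet A := A.toFinite.measurableSet
  let last (z : Finset.Iic n → S) : S := z ⟨n, Finset.mem_Iic.2 le_rfl⟩
  have h_joint : (chainLaw Q x₀).map (Preorder.frestrictLe n) ⊗ₘ
      (stepKernel Q).comap last (measurable_pi_apply _) =
      (chainLaw Q x₀).map fun ω => (Preorder.frestrictLe n ω, ω (n + 1)) :=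
    Kernel.map_frestrictLe_trajMeasure_compProd_eq_map_trajMeasure
  calc ∫ ω in Preorder.frestrictLe n ⁻¹' A, F (ω (n + 1)) ∂chainLaw Q x₀
      = ∫ p in A ×ˢ Set.univ, F p.2
          ∂((chainLaw Q x₀).map fun ω => (Preorder.frestrictLe n ω, ω (n + 1))) := by
        rw [setIntegral_map (hA.prod .univ) (Measurable.of_discrete.aestronglyMeasurable)
          (by fun_prop)]
        congr 2
        ext ω
        simp
    _ = ∫ z in A, Q.1.mulVec F (last z) ∂(chainLaw Q x₀).map (Preorder.frestrictLe n) := by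
        rw [← h_joint, Measure.setIntegral_compProd hA .univ Integrable.of_finite.integrableOn]
        simp only [Kernel.comap_apply, Measure.restrict_univ, integral_stepKernel]
    _ = ∫ ω in Preorder.frestrictLe n ⁻¹' A, Q.1.mulVec F (ω n) ∂chainLaw Q x₀ :=
        setIntegral_map hA Measurable.of_discrete.aestronglyMeasurable (by fun_prop)

end MarkovProperty

section KilledExpectation

variable {S : Type*} [Fintype S] [DecidableEq S] [MeasurableSpace S] [MeasurableSingletonClass S]
  {Q : Matrix.rowStochastic ℝ S} {T : Set S} {x₀ : S} {F G h W : S → ℝ}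

/-- The killed expectation `𝔼_{x₀}[F (X n); n < τ]` of the chain stopped at the hitting time `τ`
of `T`. -/
noncomputable def killedExp (Q : Matrix.rowStochastic ℝ S) (T : Set S) (x₀ : S) (n : ℕ)
    (F : S → ℝ) : ℝ :=
  ∫ ω in {ω | (n : ℕ∞) < hittingTime T ω}, F (ω n) ∂chainLaw Q x₀

theorem integrable_eval (F : S → ℝ) (n : ℕ) : Integrable (fun ω => F (ω n)) (chainLaw Q x₀) :=
  Integrable.comp_measurable (g := F) .of_finite (measurable_pi_apply n)

theorem killedExp_one (n : ℕ) :
    killedExp Q T x₀ n (fun _ => 1) = (chainLaw Q x₀).real {ω | (n : ℕ∞) < hittingTime T ω} := by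
  simp [killedExp]

theorem killedExp_add (n : ℕ) :
    killedExp Q T x₀ n (fun x => F x + G x) = killedExp Q T x₀ n F + killedExp Q T x₀ n G :=
  integral_add (integrable_eval F n).integrableOn (integrable_eval G n).integrableOn

theorem killedExp_const_mul (c : ℝ) (n : ℕ) :
    killedExp Q T x₀ n (fun x => c * F x) = c * killedExp Q T x₀ n F :=
  integral_const_mul _ _

theorem abs_killedExp_le (n : ℕ) :
    |killedExp Q T x₀ n F| ≤ killedExp Q T x₀ n fun x => |F x| :=
  abs_integral_le_integral_abs

theorem killedExp_nonneg (hF : ∀ x, 0 ≤ F x) (n : ℕ) : 0 ≤ killedExp Q T x₀ n F :=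
  integral_nonneg fun _ => hF _

theorem killedExp_mono (hFG : ∀ x ∉ T, F x ≤ G x) (n : ℕ) :
    killedExp Q T x₀ n F ≤ killedExp Q T x₀ n G :=
  setIntegral_mono_on (integrable_eval F n).integrableOn (integrable_eval G n).integrableOn
    (measurableSet_lt_hittingTime T.toFinite.measurableSet n)
    fun _ hω => hFG _ (lt_hittingTime_iff.1 hω n le_rfl)

theorem killedExp_congr (hFG : ∀ x ∉ T, F x = G x) (n : ℕ) :
    killedExp Q T x₀ n F = killedExp Q T x₀ n G :=
  (killedExp_mono (fun x hx => (hFG x hx).le) n).antisymm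
    (killedExp_mono (fun x hx => (hFG x hx).ge) n)

theorem setIntegral_lt_hittingTime_succ (F : S → ℝ) (n : ℕ) :
    ∫ ω in {ω | (n : ℕ∞) < hittingTime T ω}, F (ω (n + 1)) ∂chainLaw Q x₀ =
      killedExp Q T x₀ n (Q.1.mulVec F) := by
  rw [killedExp, setOf_lt_hittingTime_eq_preimage, setIntegral_chainLaw_succ]

theorem killedExp_succ (hF : ∀ x ∈ T, F x = 0) (n : ℕ) :
    killedExp Q T x₀ (n + 1) F = killedExp Q T x₀ n (Q.1.mulVec F) := by
  rw [← setIntegral_lt_hittingTime_succ, killedExp]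
  refine (setIntegral_eq_of_subset_of_forall_sdiff_eq_zero
    (measurableSet_lt_hittingTime T.toFinite.measurableSet n)
    (antitone_setOf_lt_hittingTime T n.le_succ) fun ω hω => hF _ ?_).symm
  by_contra h_notMem
  refine hω.2 (lt_hittingTime_iff.2 fun i hi => ?_)
  rcases Nat.le_add_one_iff.1 hi with hi | rfl
  · exact lt_hittingTime_iff.1 hω.1 i hi
  · exact h_notMem

theorem killedExp_succ_le (hF : ∀ x, 0 ≤ F x) (n : ℕ) :
    killedExp Q T x₀ (n + 1) F ≤ killedExp Q T x₀ n (Q.1.mulVec F) := by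
  rw [← setIntegral_lt_hittingTime_succ]
  exact setIntegral_mono_set (integrable_eval F (n + 1)).integrableOn (ae_of_all _ fun _ => hF _)
    (antitone_setOf_lt_hittingTime T n.le_succ).eventuallyLE

theorem integral_eval_zero (F : S → ℝ) : ∫ ω, F (ω 0) ∂chainLaw Q x₀ = F x₀ := by
  have h_ae : (fun ω => F (ω 0)) =ᵐ[chainLaw Q x₀] fun _ => F x₀ := by
    filter_upwards [ae_chainLaw_zero Q x₀] with ω hω using by rw [hω]
  simp [integral_congr_ae h_ae]

theorem killedExp_zero (hF : ∀ x ∈ T, F x = 0) : killedExp Q T x₀ 0 F = F x₀ := by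
  rw [← integral_eval_zero (Q := Q) F]
  refine setIntegral_eq_integral_of_forall_compl_eq_zero fun ω hω => hF _ ?_
  by_contra h_notMem
  exact hω (lt_hittingTime_iff.2 fun i hi => by rwa [Nat.le_zero.1 hi])

theorem killedExp_zero_le (hF : ∀ x, 0 ≤ F x) : killedExp Q T x₀ 0 F ≤ F x₀ := by
  rw [← integral_eval_zero (Q := Q) F]
  exact setIntegral_le_integral (integrable_eval F 0) (ae_of_all _ fun _ => hF _)

theorem sum_killedExp_le (hW : ∀ x, 0 ≤ W x) (hFW : ∀ x ∉ T, F x + Q.1.mulVec W x ≤ W x)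
    (n : ℕ) : ∑ k ∈ Finset.range n, killedExp Q T x₀ k F ≤ W x₀ := by
  have h_step (k : ℕ) :
      killedExp Q T x₀ k F ≤ killedExp Q T x₀ k W - killedExp Q T x₀ (k + 1) W := by
    have h_drift := killedExp_mono (Q := Q) (x₀ := x₀) hFW k
    rw [killedExp_add] at h_drift
    linarith [killedExp_succ_le (Q := Q) (T := T) (x₀ := x₀) hW k]
  calc ∑ k ∈ Finset.range n, killedExp Q T x₀ k F
      ≤ killedExp Q T x₀ 0 W - killedExp Q T x₀ n W :=
        (Finset.sum_le_sum fun k _ => h_step k).trans_eq (Finset.sum_range_sub' _ n)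
    _ ≤ W x₀ := by linarith [killedExp_zero_le (Q := Q) (T := T) (x₀ := x₀) hW,
        killedExp_nonneg (Q := Q) (T := T) (x₀ := x₀) hW n]

end KilledExpectation

section MeanHittingTime

variable {S : Type*} [Fintype S] {T : Set S} {h W : S → ℝ}

/-- `h` is a mean hitting time of `T` for the transition matrix `P`: a nonnegative solution of the
Poisson equation `h = 1 + P h` off `T` with boundary values `0` on `T`. -/
structure IsMeanHittingTime (P : Matrix S S ℝ) (T : Set S) (h : S → ℝ) : Prop where
  nonneg : ∀ x, 0 ≤ h x
  eq_zero : ∀ x ∈ T, h x = 0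
  poisson : ∀ x ∉ T, h x = 1 + P.mulVec h x

/-- `W` is a corrector for `h` at `x₀`: a nonnegative function whose downward drift off `T`
dominates the deviation of `h` from its value at `x₀`. -/
structure IsCorrector (P : Matrix S S ℝ) (T : Set S) (x₀ : S) (h W : S → ℝ) : Prop where
  nonneg : ∀ x, 0 ≤ W x
  drift : ∀ x ∉ T, |h x - h x₀| + P.mulVec W x ≤ W x

variable [DecidableEq S] [MeasurableSpace S] [MeasurableSingletonClass S]
  {Q : Matrix.rowStochastic ℝ S} {x₀ : S}

namespace IsMeanHittingTime

theorem killedExp_sub_killedExp_succ (hh : IsMeanHittingTime Q.1 T h) (n : ℕ) :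
    killedExp Q T x₀ n h - killedExp Q T x₀ (n + 1) h =
      (chainLaw Q x₀).real {ω | (n : ℕ∞) < hittingTime T ω} := by
  rw [killedExp_congr hh.poisson, killedExp_add, killedExp_one, killedExp_succ hh.eq_zero]
  ring

theorem sum_real_lt_hittingTime (hh : IsMeanHittingTime Q.1 T h) (n : ℕ) :
    ∑ k ∈ Finset.range n, (chainLaw Q x₀).real {ω | (k : ℕ∞) < hittingTime T ω} =
      h x₀ - killedExp Q T x₀ n h := by
  simp_rw [← hh.killedExp_sub_killedExp_succ, Finset.sum_range_sub', killedExp_zero hh.eq_zero]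

theorem summable_real_lt_hittingTime (hh : IsMeanHittingTime Q.1 T h) :
    Summable fun n : ℕ => (chainLaw Q x₀).real {ω | (n : ℕ∞) < hittingTime T ω} :=
  summable_of_sum_range_le (c := h x₀) (fun _ => measureReal_nonneg) fun n => by
    linarith [hh.sum_real_lt_hittingTime (x₀ := x₀) n,
      killedExp_nonneg (Q := Q) (T := T) (x₀ := x₀) hh.nonneg n]

theorem tendsto_killedExp (hh : IsMeanHittingTime Q.1 T h) :
    Tendsto (fun n => killedExp Q T x₀ n h) atTop (𝓝 0) := by
  have h_le (n : ℕ) : killedExp Q T x₀ n h ≤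
      (∑ x, h x) * (chainLaw Q x₀).real {ω | (n : ℕ∞) < hittingTime T ω} := by
    rw [← killedExp_one, ← killedExp_const_mul]
    refine killedExp_mono (fun x _ => ?_) n
    rw [mul_one]
    exact Finset.single_le_sum (fun y _ => hh.nonneg y) (Finset.mem_univ x)
  refine squeeze_zero (killedExp_nonneg hh.nonneg) h_le ?_
  simpa using (hh.summable_real_lt_hittingTime (x₀ := x₀)).tendsto_atTop_zero.const_mul (∑ x, h x)

theorem hasSum_real_lt_hittingTime (hh : IsMeanHittingTime Q.1 T h) :
    HasSum (fun n : ℕ => (chainLaw Q x₀).real {ω | (n : ℕ∞) < hittingTime T ω}) (h x₀) := by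
  rw [hh.summable_real_lt_hittingTime.hasSum_iff_tendsto_nat]
  simp_rw [hh.sum_real_lt_hittingTime]
  simpa using tendsto_const_nhds.sub (hh.tendsto_killedExp (x₀ := x₀))

theorem lintegral_hittingTime (hh : IsMeanHittingTime Q.1 T h) :
    ∫⁻ ω, (hittingTime T ω : ℝ≥0∞) ∂chainLaw Q x₀ = ENNReal.ofReal (h x₀) := by
  rw [lintegral_toENNReal_eq_tsum (measurable_hittingTime T.toFinite.measurableSet),
    ← hh.hasSum_real_lt_hittingTime.tsum_eq,
    ENNReal.ofReal_tsum_of_nonneg (fun _ => measureReal_nonneg) hh.summable_real_lt_hittingTime]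
  simp

theorem ae_hittingTime_ne_top (hh : IsMeanHittingTime Q.1 T h) :
    ∀ᵐ ω ∂chainLaw Q x₀, hittingTime T ω ≠ ⊤ :=
  ae_ne_top_of_lintegral_toENNReal_ne_top (measurable_hittingTime T.toFinite.measurableSet)
    (hh.lintegral_hittingTime.trans_ne ENNReal.ofReal_ne_top)

theorem abs_killedExp_sub_le (n : ℕ) :
    |killedExp Q T x₀ n h - h x₀ * (chainLaw Q x₀).real {ω | (n : ℕ∞) < hittingTime T ω}| ≤
      killedExp Q T x₀ n fun x => |h x - h x₀| := by
  have h_sub : killedExp Q T x₀ n (fun x => h x + -h x₀ * 1) = killedExp Q T x₀ n h -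
      h x₀ * (chainLaw Q x₀).real {ω | (n : ℕ∞) < hittingTime T ω} := by
    rw [killedExp_add, killedExp_const_mul, killedExp_one]
    ring
  rw [← h_sub]
  simpa [sub_eq_add_neg] using abs_killedExp_le (Q := Q) (T := T) (x₀ := x₀)
    (F := fun x => h x + -h x₀ * 1) n

end IsMeanHittingTime

theorem IsCorrector.sum_abs_killedExp_sub_le (hW : IsCorrector Q.1 T x₀ h W) (n : ℕ) :
    ∑ k ∈ Finset.range n, |killedExp Q T x₀ k h -
      h x₀ * (chainLaw Q x₀).real {ω | (k : ℕ∞) < hittingTime T ω}| ≤ W x₀ :=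
  (Finset.sum_le_sum fun k _ => IsMeanHittingTime.abs_killedExp_sub_le k).trans
    (sum_killedExp_le hW.nonneg hW.drift n)

theorem tendstoInDistribution_hittingTime {ι : Type*} {l : Filter ι} [l.IsCountablyGenerated]
    {S : ι → Type*} [∀ i, Fintype (S i)] [∀ i, DecidableEq (S i)] [∀ i, MeasurableSpace (S i)]
    [∀ i, MeasurableSingletonClass (S i)] {Q : ∀ i, Matrix.rowStochastic ℝ (S i)}
    {T : ∀ i, Set (S i)} {x₀ : ∀ i, S i} {h W : ∀ i, S i → ℝ}
    (hh : ∀ i, IsMeanHittingTime (Q i).1 (T i) (h i))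
    (hW : ∀ i, IsCorrector (Q i).1 (T i) (x₀ i) (h i) (W i))
    (hm : Tendsto (fun i => h i (x₀ i)) l atTop)
    (hWm : Tendsto (fun i => W i (x₀ i) / h i (x₀ i) ^ 2) l (𝓝 0)) :
    TendstoInDistribution (fun i ω => ((hittingTime (T i) ω).toNat : ℝ) / h i (x₀ i)) l
      (id : ℝ → ℝ) (fun i => chainLaw (Q i) (x₀ i)) (expMeasure 1) := by
  let a (i : ι) (n : ℕ) : ℝ := killedExp (Q i) (T i) (x₀ i) n (h i)
  have h_tail (i : ι) (n : ℕ) : a i n - a i (n + 1) =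
      (chainLaw (Q i) (x₀ i)).real {ω | (n : ℕ∞) < hittingTime (T i) ω} :=
    (hh i).killedExp_sub_killedExp_succ n
  have h_anti (i : ι) : Antitone fun n => a i n - a i (n + 1) := fun j k hjk => by
    simp_rw [h_tail]
    exact measureReal_mono (antitone_setOf_lt_hittingTime (T i) hjk)
  have h_sum (i : ι) (n : ℕ) : ∑ k ∈ Finset.range n,
      |a i k - h i (x₀ i) * (a i k - a i (k + 1))| ≤ W i (x₀ i) := by
    simp_rw [h_tail]
    exact (hW i).sum_abs_killedExp_sub_le n
  refine tendstoInDistribution_expMeasure_one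
    (fun i => measurable_hittingTime (T i).toFinite.measurableSet)
    (fun i => (hh i).ae_hittingTime_ne_top) hm fun t ht => ?_
  simp_rw [← h_tail]
  exact tendsto_floor_sub_succ hm (fun _ => tendsto_floor_div_of_sum_abs_le hm
    (fun i => killedExp_zero (hh i).eq_zero) h_sum hWm) h_anti ht

end MeanHittingTime

section PoissonEquation

variable {S : Type*} [Fintype S]

theorem exists_poisson_solution {P : Matrix S S ℝ} {T : Set S}
    (h_unique : ∀ u : S → ℝ, (∀ x ∈ T, u x = 0) → (∀ x ∉ T, u x = P.mulVec u x) → u = 0)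
    (f : S → ℝ) :
    ∃ u : S → ℝ, (∀ x ∈ T, u x = 0) ∧ ∀ x ∉ T, u x = f x + P.mulVec u x := by
  classical
  let K : Matrix S S ℝ := fun x y => if x ∈ T then 0 else P x y
  have hK (u : S → ℝ) (x : S) : (1 - K).mulVec u x = u x - if x ∈ T then 0 else P.mulVec u x := by
    rw [Matrix.sub_mulVec, Matrix.one_mulVec, Pi.sub_apply]
    split_ifs with hx <;> simp [K, hx, Matrix.mulVec, dotProduct]
  have h_inj : Function.Injective (1 - K).mulVec := by
    refine (injective_iff_map_eq_zero (1 - K).mulVecLin).2 fun u hu => ?_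
    have hu_apply (x : S) := (hK u x).symm.trans (congrFun hu x)
    refine h_unique u (fun x hx => ?_) fun x hx => ?_
    · simpa [hx] using hu_apply x
    · simpa [hx, sub_eq_zero] using hu_apply x
  obtain ⟨u, hu⟩ := Matrix.mulVec_surjective_iff_isUnit.2
    (Matrix.mulVec_injective_iff_isUnit.1 h_inj) fun x => if x ∈ T then 0 else f x
  have hu_apply (x : S) := (hK u x).symm.trans (congrFun hu x)
  refine ⟨u, fun x hx => ?_, fun x hx => ?_⟩
  · simpa [hx] using hu_apply x
  · simpa [hx, sub_eq_iff_eq_add] using hu_apply x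

end PoissonEquation

end Markov

namespace AltWells

section OneStepAverage

/-- The probability of a step to the right from `x`, for the walk extended to all of `ℤ`. -/
def rightProb (N : ℕ) (θ : ℝ) (x : ℤ) : ℝ := if |x| ≤ N then 1 - θ else θ

/-- The one-step average of `u` from `x`, for the walk extended to all of `ℤ`. -/
def avg (N : ℕ) (θ : ℝ) (u : ℤ → ℝ) (x : ℤ) : ℝ :=
  rightProb N θ x * u (x + 1) + (1 - rightProb N θ x) * u (x - 1)

variable {N : ℕ} {θ : ℝ}

theorem rightProb_of_abs_le {x : ℤ} (hx : |x| ≤ N) : rightProb N θ x = 1 - θ := if_pos hx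

theorem rightProb_of_lt_abs {x : ℤ} (hx : N < |x|) : rightProb N θ x = θ := if_neg hx.not_ge

theorem rightProb_nonneg (h0 : 0 < θ) (h1 : θ < 1) (x : ℤ) : 0 ≤ rightProb N θ x := by
  unfold rightProb
  split_ifs <;> linarith

theorem rightProb_lt_one (h0 : 0 < θ) (h1 : θ < 1) (x : ℤ) : rightProb N θ x < 1 := by
  unfold rightProb
  split_ifs <;> linarith

theorem avg_affine (a b : ℝ) (u : ℤ → ℝ) (x : ℤ) :
    avg N θ (fun y => a + b * u y) x = a + b * avg N θ u x := by
  unfold avg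
  ring

theorem avg_const (a : ℝ) (x : ℤ) : avg N θ (fun _ => a) x = a := by
  unfold avg
  ring

theorem avg_comp_neg (u : ℤ → ℝ) (x : ℤ) :
    avg N θ (fun y => u (-y)) x = avg N (1 - θ) u (-x) := by
  have h_prob : rightProb N (1 - θ) (-x) = 1 - rightProb N θ x := by
    unfold rightProb
    rw [abs_neg]
    split_ifs <;> ring
  simp only [avg, h_prob, neg_add', neg_sub', sub_neg_eq_add]
  ring

theorem notMem_target_iff {x : State N} : x ∉ target N ↔ -(2 * N : ℤ) < x ∧ (x : ℤ) < 2 * N := by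
  have hx := Set.mem_Icc.1 x.2
  simp only [target, Set.mem_ofPred_eq, not_or]
  omega

theorem mulVec_eq_avg (θ : unitInterval) (B : Matrix.rowStochastic ℝ (State N)) {x : State N}
    (hx : x ∉ target N) (u : ℤ → ℝ) :
    (Q N θ B).1.mulVec (fun y => u y) x = avg N θ u x := by
  have h_term (y : State N) : (Q N θ B).1 x y * u y =
      if (y : ℤ) = x + 1 then rightProb N θ x * u (x + 1)
      else if (y : ℤ) = x - 1 then (1 - rightProb N θ x) * u (x - 1) else 0 := by
    simp only [Q, entry, hx, if_false, rightProb]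
    split_ifs <;> simp_all
  simp only [Matrix.mulVec, dotProduct, h_term]
  exact sum_step hx _ _

end OneStepAverage

section MaximumPrinciple

theorem nonpos_of_subharmonic {a b : ℤ} {r u : ℤ → ℝ} (hr0 : ∀ x, 0 ≤ r x) (hr1 : ∀ x, r x < 1)
    (ha : u a ≤ 0) (hb : u b ≤ 0)
    (hu : ∀ x, a < x → x < b → u x ≤ r x * u (x + 1) + (1 - r x) * u (x - 1)) {x : ℤ}
    (hax : a ≤ x) (hxb : x ≤ b) : u x ≤ 0 := by
  by_contra! hx
  -- The leftmost maximum `w` would be interior, with `u (w - 1) < u w` and `u (w + 1) ≤ u w`.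
  obtain ⟨y, hy, h_max⟩ := (Finset.Icc a b).exists_max_image u ⟨x, Finset.mem_Icc.2 ⟨hax, hxb⟩⟩
  obtain ⟨w, hw, h_leftmost⟩ := ((Finset.Icc a b).filter fun w => u w = u y).exists_min_image id
    ⟨y, by simpa using hy⟩
  obtain ⟨hw_mem, hw_max⟩ := Finset.mem_filter.1 hw
  obtain ⟨haw, hwb⟩ := Finset.mem_Icc.1 hw_mem
  have h_le (z : ℤ) (haz : a ≤ z) (hzb : z ≤ b) : u z ≤ u w :=
    hw_max ▸ h_max z (Finset.mem_Icc.2 ⟨haz, hzb⟩)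
  have h_pos : 0 < u w := hx.trans_le (h_le x hax hxb)
  have haw' : a < w := lt_of_le_of_ne haw (by rintro rfl; linarith)
  have hwb' : w < b := lt_of_le_of_ne hwb (by rintro rfl; linarith)
  have h_right : u (w + 1) ≤ u w := h_le _ (by omega) (by omega)
  have h_left : u (w - 1) < u w := by
    refine lt_of_le_of_ne (h_le _ (by omega) (by omega)) fun h_eq => ?_
    have : w ≤ w - 1 := h_leftmost (w - 1)
      (Finset.mem_filter.2 ⟨Finset.mem_Icc.2 ⟨by omega, by omega⟩, h_eq.trans hw_max⟩)
    omega
  have h_right' := mul_le_mul_of_nonneg_left h_right (hr0 w)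
  have h_left' := mul_lt_mul_of_pos_left h_left (sub_pos.2 (hr1 w))
  linarith [hu w haw' hwb']

variable {N : ℕ} {θ : ℝ} {f g : ℤ → ℝ}

theorem le_of_drift_le (h0 : 0 < θ) (h1 : θ < 1) {a b : ℤ} (ha : f a ≤ g a) (hb : f b ≤ g b)
    (h_drift : ∀ x, a < x → x < b → f x - avg N θ f x ≤ g x - avg N θ g x) {x : ℤ}
    (hax : a ≤ x) (hxb : x ≤ b) : f x ≤ g x := by
  refine sub_nonpos.1 (nonpos_of_subharmonic (u := fun y => f y - g y) (rightProb_nonneg h0 h1)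
    (rightProb_lt_one (N := N) h0 h1) (sub_nonpos.2 ha) (sub_nonpos.2 hb) (fun y hay hyb => ?_)
    hax hxb)
  have := h_drift y hay hyb
  unfold avg at this
  linarith

theorem le_of_drift_le_of_ne (h0 : 0 < θ) (h1 : θ < 1) (h_left : f (-(2 * N)) ≤ g (-(2 * N)))
    (h_well : f N ≤ g N) (h_right : f (2 * N) ≤ g (2 * N))
    (h_drift : ∀ x : ℤ, -(2 * N) < x → x < 2 * N → x ≠ N →
      f x - avg N θ f x ≤ g x - avg N θ g x) {x : ℤ} (hx : -(2 * N) ≤ x) (hx' : x ≤ 2 * N) :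
    f x ≤ g x := by
  rcases le_total x N with hxN | hxN
  · exact le_of_drift_le h0 h1 h_left h_well
      (fun y hy hy' => h_drift y hy (by omega) (by omega)) hx hxN
  · exact le_of_drift_le h0 h1 h_well h_right
      (fun y hy hy' => h_drift y (by omega) hy' (by omega)) hxN hx'

end MaximumPrinciple

/-- `h` is the mean hitting time of `±2N` as a function of the starting point, for the walk on
`ℤ`: it vanishes at `±2N` and satisfies `h = 1 + avg h` in between. -/
structure IsMeanTime (N : ℕ) (θ : ℝ) (h : ℤ → ℝ) : Prop where
  left : h (-(2 * N)) = 0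
  right : h (2 * N) = 0
  poisson : ∀ x : ℤ, -(2 * N) < x → x < 2 * N → h x = 1 + avg N θ h x

/-- `W` is a corrector for `h` on `[-2N, 2N]`, as in `Markov.IsCorrector`, at the point `0`. -/
structure IsCorrector (N : ℕ) (θ : ℝ) (h W : ℤ → ℝ) : Prop where
  nonneg : ∀ x : ℤ, -(2 * N) ≤ x → x ≤ 2 * N → 0 ≤ W x
  drift : ∀ x : ℤ, -(2 * N) < x → x < 2 * N → |h x - h 0| + avg N θ W x ≤ W x

section MeanTime

variable {N : ℕ} {θ : ℝ} {h W : ℤ → ℝ}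

theorem IsMeanTime.drift (hh : IsMeanTime N θ h) {x : ℤ} (hx : -(2 * N) < x) (hx' : x < 2 * N) :
    h x - avg N θ h x = 1 := by
  linarith [hh.poisson x hx hx']

theorem IsMeanTime.nonneg (hh : IsMeanTime N θ h) (h0 : 0 < θ) (h1 : θ < 1) {x : ℤ}
    (hx : -(2 * N) ≤ x) (hx' : x ≤ 2 * N) : 0 ≤ h x := by
  refine le_of_drift_le (N := N) (f := fun _ => 0) h0 h1 hh.left.ge hh.right.ge
    (fun y hy hy' => ?_) hx hx'
  rw [avg_const, hh.drift hy hy', sub_zero]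
  exact zero_le_one

theorem exists_isMeanTime (N : ℕ) (h0 : 0 < θ) (h1 : θ < 1) : ∃ h, IsMeanTime N θ h := by
  have hN : -(2 * N : ℤ) ≤ 2 * N := by omega
  let θ' : unitInterval := ⟨θ, h0.le, h1.le⟩
  have h_avg (u : State N → ℝ) {x : State N} (hx : x ∉ target N) :
      (Q N θ' 1).1.mulVec u x = avg N θ (Set.IccExtend hN u) x := by
    rw [← mulVec_eq_avg θ' 1 hx]
    simp only [Set.IccExtend_val]
  have h_unique (u : State N → ℝ) (hu : ∀ x ∈ target N, u x = 0)
      (hu' : ∀ x ∉ target N, u x = (Q N θ' 1).1.mulVec u x) : u = 0 := by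
    let v := Set.IccExtend hN u
    have h_left : v (-(2 * N)) = 0 := (Set.IccExtend_left hN u).trans (hu _ (Or.inl rfl))
    have h_right : v (2 * N) = 0 := (Set.IccExtend_right hN u).trans (hu _ (Or.inr rfl))
    have h_drift (x : ℤ) (hx : -(2 * N) < x) (hx' : x < 2 * N) :
        v x - avg N θ v x = 0 - avg N θ (fun _ => 0) x := by
      have hxT : (⟨x, hx.le, hx'.le⟩ : State N) ∉ target N := notMem_target_iff.2 ⟨hx, hx'⟩
      rw [avg_const, sub_zero, sub_eq_zero, ← h_avg u hxT, ← hu' _ hxT]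
      exact Set.IccExtend_val hN u ⟨x, _⟩
    funext x
    rw [← Set.IccExtend_val hN u x]
    exact le_antisymm
      (le_of_drift_le (g := fun _ => 0) h0 h1 h_left.le h_right.le
        (fun y hy hy' => (h_drift y hy hy').le) x.2.1 x.2.2)
      (le_of_drift_le (f := fun _ => 0) h0 h1 h_left.ge h_right.ge
        (fun y hy hy' => (h_drift y hy hy').ge) x.2.1 x.2.2)
  obtain ⟨u, hu, hu'⟩ := Markov.exists_poisson_solution h_unique 1
  refine ⟨Set.IccExtend hN u, (Set.IccExtend_left hN u).trans (hu _ (Or.inl rfl)),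
    (Set.IccExtend_right hN u).trans (hu _ (Or.inr rfl)), fun x hx hx' => ?_⟩
  have hxT : (⟨x, hx.le, hx'.le⟩ : State N) ∉ target N := notMem_target_iff.2 ⟨hx, hx'⟩
  rw [← h_avg u hxT]
  exact (Set.IccExtend_val hN u ⟨x, _⟩).trans (hu' _ hxT)

theorem IsMeanTime.isMeanHittingTime {θ : unitInterval} (hh : IsMeanTime N θ h)
    (h0 : (0 : ℝ) < θ) (h1 : (θ : ℝ) < 1) (B : Matrix.rowStochastic ℝ (State N)) :
    Markov.IsMeanHittingTime (Q N θ B).1 (target N) fun x => h x where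
  nonneg x := hh.nonneg h0 h1 x.2.1 x.2.2
  eq_zero x hx := by
    rcases hx with hx | hx
    · rw [hx, hh.left]
    · rw [hx, hh.right]
  poisson x hx := by
    rw [mulVec_eq_avg θ B hx]
    exact hh.poisson x (notMem_target_iff.1 hx).1 (notMem_target_iff.1 hx).2

theorem IsCorrector.isCorrector {θ : unitInterval} (hW : IsCorrector N θ h W)
    (B : Matrix.rowStochastic ℝ (State N)) :
    Markov.IsCorrector (Q N θ B).1 (target N) (origin N) (fun x => h x) fun x => W x where
  nonneg x := hW.nonneg x x.2.1 x.2.2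
  drift x hx := by
    rw [mulVec_eq_avg θ B hx]
    exact hW.drift x (notMem_target_iff.1 hx).1 (notMem_target_iff.1 hx).2

theorem IsMeanTime.comp_neg (hh : IsMeanTime N (1 - θ) h) : IsMeanTime N θ fun x => h (-x) where
  left := by rw [neg_neg, hh.right]
  right := hh.left
  poisson x hx hx' := by
    rw [avg_comp_neg]
    exact hh.poisson (-x) (by omega) (by omega)

theorem IsCorrector.comp_neg (hW : IsCorrector N (1 - θ) h W) :
    IsCorrector N θ (fun x => h (-x)) fun x => W (-x) where
  nonneg x hx hx' := hW.nonneg (-x) (by omega) (by omega)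
  drift x hx hx' := by
    rw [avg_comp_neg, neg_zero]
    exact hW.drift (-x) (by omega) (by omega)

end MeanTime

section Potentials

/-- The distance of `x` to the nearer of `N` and `-3N`. For `x` in `[-2N, 2N]` and `θ < 1/2` the
walk is pushed towards smaller values: to the right of the saddle `-N` it is drawn into the well at
`N`, and to its left into a virtual well at `-3N`, beyond the target `-2N`. -/
def wellDist (N : ℕ) (x : ℤ) : ℕ := ((x + N).natAbs - 2 * N : ℤ).natAbs

/-- The base `ρ` of the exponential potentials. Any `ρ` strictly between `1` and `(1 - θ) / θ`
would do; this one satisfies `ρ - 1 = 1 - 2θ`. -/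
def growthRate (θ : ℝ) : ℝ := 2 * (1 - θ)

/-- The relative decrease `1 - ((1 - θ) / ρ + θ ρ)` of `ρ ^ k` under a step of the walk on `ℕ`
which goes down with probability `1 - θ`. -/
noncomputable def decayRate (θ : ℝ) : ℝ := (1 - 2 * θ) ^ 2 / 2

/-- The potential `ρ ^ wellDist`, which on `[-2N, 2N]` decreases on average except at `N`. -/
def wellPotential (N : ℕ) (θ : ℝ) (x : ℤ) : ℝ := growthRate θ ^ wellDist N x

/-- The potential equal to `1` to the left of the saddle `-N` and to `ρ ^ (-(x + N))` to its
right. It decreases on average to the left of `N`, so it bounds the probability that the walk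
started from `x` reaches `-2N` before `N`. -/
noncomputable def saddlePotential (N : ℕ) (θ : ℝ) (x : ℤ) : ℝ := (growthRate θ)⁻¹ ^ (x + N).toNat

variable {N : ℕ} {θ : ℝ}

theorem wellDist_self : wellDist N N = 0 := by
  unfold wellDist
  omega

theorem wellDist_zero : wellDist N 0 = N := by
  unfold wellDist
  omega

theorem wellDist_left : wellDist N (-(2 * N)) = N := by
  unfold wellDist
  omega

theorem wellDist_right : wellDist N (2 * N) = N := by
  unfold wellDist
  omega

theorem wellDist_le {x : ℤ} (hx : -(2 * N) ≤ x) (hx' : x ≤ 2 * N) : wellDist N x ≤ 2 * N := by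
  unfold wellDist
  omega

theorem wellDist_pos {x : ℤ} (hx : -(2 * N) < x) (hxN : x ≠ N) : 0 < wellDist N x := by
  unfold wellDist
  omega

theorem avg_comp_wellDist_le (h0 : 0 < θ) {φ : ℕ → ℝ} (hφ : Monotone φ) {x : ℤ}
    (hx : -(2 * N) < x) (hxN : x ≠ N) :
    avg N θ (fun y => φ (wellDist N y)) x ≤
      (1 - θ) * φ (wellDist N x - 1) + θ * φ (wellDist N x + 1) := by
  simp only [avg]
  rcases le_or_gt |x| (N : ℤ) with hxN' | hxN'
  · obtain ⟨_, _⟩ := abs_le.1 hxN'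
    have h_down : wellDist N (x + 1) = wellDist N x - 1 := by
      unfold wellDist
      omega
    have h_up : wellDist N (x - 1) ≤ wellDist N x + 1 := by
      unfold wellDist
      omega
    rw [rightProb_of_abs_le hxN', sub_sub_cancel, h_down]
    gcongr
    exact hφ h_up
  · have : x < -N ∨ N < x := by
      have := lt_abs.1 hxN'
      omega
    have h_down : wellDist N (x - 1) = wellDist N x - 1 := by
      unfold wellDist
      omega
    have h_up : wellDist N (x + 1) ≤ wellDist N x + 1 := by
      unfold wellDist
      omega
    rw [rightProb_of_lt_abs hxN', h_down, add_comm]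
    gcongr
    exact hφ h_up

theorem avg_wellDist_le (h0 : 0 < θ) {x : ℤ} (hx : -(2 * N) < x) (hxN : x ≠ N) :
    avg N θ (fun y => (wellDist N y : ℝ)) x ≤ wellDist N x - (1 - 2 * θ) := by
  refine (avg_comp_wellDist_le h0 Nat.mono_cast hx hxN).trans_eq ?_
  rw [Nat.cast_pred (wellDist_pos hx hxN)]
  push_cast
  ring

theorem one_lt_growthRate (h1 : θ < 1 / 2) : 1 < growthRate θ := by
  unfold growthRate
  linarith

theorem growthRate_pos (h1 : θ < 1 / 2) : 0 < growthRate θ :=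
  one_pos.trans (one_lt_growthRate h1)

theorem decayRate_pos (h1 : θ < 1 / 2) : 0 < decayRate θ :=
  div_pos (pow_pos (by linarith) 2) two_pos

theorem growthRate_average (h1 : θ < 1 / 2) :
    (1 - θ) * (growthRate θ)⁻¹ + θ * growthRate θ = 1 - decayRate θ := by
  have : 1 - θ ≠ 0 := by linarith
  unfold growthRate decayRate
  field_simp
  ring

theorem wellPotential_nonneg (h1 : θ < 1 / 2) (x : ℤ) : 0 ≤ wellPotential N θ x :=
  pow_nonneg (growthRate_pos h1).le _

theorem wellPotential_self : wellPotential N θ N = 1 := by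
  rw [wellPotential, wellDist_self, pow_zero]

theorem wellPotential_zero : wellPotential N θ 0 = growthRate θ ^ N := by
  rw [wellPotential, wellDist_zero]

theorem wellPotential_left : wellPotential N θ (-(2 * N)) = growthRate θ ^ N := by
  rw [wellPotential, wellDist_left]

theorem wellPotential_right : wellPotential N θ (2 * N) = growthRate θ ^ N := by
  rw [wellPotential, wellDist_right]

theorem avg_wellPotential_self : avg N θ (wellPotential N θ) N = growthRate θ := by
  have h_right : wellDist N (N + 1) = 1 := by
    unfold wellDist
    omega
  have h_left : wellDist N (N - 1) = 1 := by
    unfold wellDist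
    omega
  unfold avg wellPotential
  rw [h_right, h_left]
  ring

theorem avg_wellPotential_le (h0 : 0 < θ) (h1 : θ < 1 / 2) {x : ℤ} (hx : -(2 * N) < x)
    (hxN : x ≠ N) :
    avg N θ (wellPotential N θ) x ≤ (1 - decayRate θ) * wellPotential N θ x := by
  obtain ⟨k, hk⟩ := Nat.exists_eq_succ_of_ne_zero (wellDist_pos hx hxN).ne'
  refine (avg_comp_wellDist_le h0 (pow_right_mono₀ (one_lt_growthRate h1).le) hx hxN).trans_eq ?_
  have := (growthRate_pos h1).ne'
  rw [← growthRate_average h1, wellPotential, hk, Nat.succ_sub_one, pow_succ, pow_succ]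
  field_simp

theorem decayRate_mul_wellPotential_add_avg_le (h0 : 0 < θ) (h1 : θ < 1 / 2) {x : ℤ}
    (hx : -(2 * N) < x) :
    decayRate θ * wellPotential N θ x + avg N θ (wellPotential N θ) x ≤
      wellPotential N θ x + 2 := by
  rcases eq_or_ne x N with rfl | hxN
  · rw [avg_wellPotential_self, wellPotential_self, decayRate, growthRate]
    nlinarith
  · linarith [avg_wellPotential_le h0 h1 hx hxN]

theorem saddlePotential_left : saddlePotential N θ (-(2 * N)) = 1 := by
  rw [saddlePotential, Int.toNat_of_nonpos (by omega), pow_zero]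

theorem saddlePotential_zero : saddlePotential N θ 0 = (growthRate θ ^ N)⁻¹ := by
  rw [saddlePotential, zero_add, Int.toNat_natCast, inv_pow]

theorem saddlePotential_nonneg (h1 : θ < 1 / 2) (x : ℤ) : 0 ≤ saddlePotential N θ x :=
  pow_nonneg (inv_nonneg.2 (growthRate_pos h1).le) _

theorem avg_saddlePotential_le (h1 : θ < 1 / 2) {x : ℤ} (hxN : x < N) :
    avg N θ (saddlePotential N θ) x ≤ saddlePotential N θ x := by
  have hρ := growthRate_pos h1
  unfold avg saddlePotential
  rcases lt_or_ge x (-N) with hx | hx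
  · rw [Int.toNat_of_nonpos (by omega : x + 1 + N ≤ 0), Int.toNat_of_nonpos (by omega : x + N ≤ 0),
      Int.toNat_of_nonpos (by omega : x - 1 + N ≤ 0)]
    simp
  · rw [rightProb_of_abs_le (abs_le.2 ⟨hx, hxN.le⟩), sub_sub_cancel]
    obtain ⟨k, rfl⟩ : ∃ k : ℕ, x = k - N := ⟨(x + N).toNat, by omega⟩
    have h_right : ((k : ℤ) - N + 1 + N).toNat = k + 1 := by omega
    have h_mid : ((k : ℤ) - N + N).toNat = k := by omega
    have h_left : ((k : ℤ) - N - 1 + N).toNat = k - 1 := by omega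
    rw [h_right, h_mid, h_left]
    rcases k with _ | k
    · have : (growthRate θ)⁻¹ ≤ 1 := inv_le_one_of_one_le₀ (one_lt_growthRate h1).le
      simp only [zero_add, pow_one, zero_tsub, pow_zero]
      nlinarith
    · have h_step : (1 - θ) * (growthRate θ)⁻¹ ^ (k + 1 + 1) + θ * (growthRate θ)⁻¹ ^ k =
          (1 - decayRate θ) * (growthRate θ)⁻¹ ^ (k + 1) := by
        rw [← growthRate_average h1, pow_succ _ (k + 1), pow_succ _ k]
        field_simp
      rw [Nat.add_sub_cancel, h_step]
      exact mul_le_of_le_one_left (by positivity) (by linarith [decayRate_pos h1])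

end Potentials

section Bounds

variable {N : ℕ} {θ : ℝ} {h : ℤ → ℝ}

theorem IsMeanTime.le_add_wellDist (hh : IsMeanTime N θ h) (h0 : 0 < θ) (h1 : θ < 1 / 2) {x : ℤ}
    (hx : -(2 * N) ≤ x) (hx' : x ≤ 2 * N) : h x ≤ h N + (1 - 2 * θ)⁻¹ * wellDist N x := by
  have h_gap : 0 < 1 - 2 * θ := by linarith
  have h_nonneg (y : ℤ) : 0 ≤ h N + (1 - 2 * θ)⁻¹ * wellDist N y :=
    add_nonneg (hh.nonneg h0 (by linarith) (by omega) (by omega)) (by positivity)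
  refine le_of_drift_le_of_ne (N := N) (g := fun y => h N + (1 - 2 * θ)⁻¹ * wellDist N y) h0
    (by linarith) (hh.left.trans_le (h_nonneg _)) (by simp [wellDist_self])
    (hh.right.trans_le (h_nonneg _)) (fun y hy hy' hyN => ?_) hx hx'
  rw [hh.drift hy hy', avg_affine, add_sub_add_left_eq_sub, ← mul_sub]
  calc (1 : ℝ) = (1 - 2 * θ)⁻¹ * (1 - 2 * θ) := (inv_mul_cancel₀ h_gap.ne').symm
    _ ≤ _ := mul_le_mul_of_nonneg_left (by linarith [avg_wellDist_le h0 hy hyN])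
      (inv_nonneg.2 h_gap.le)

theorem IsMeanTime.sub_wellPotential_le (hh : IsMeanTime N θ h) (h0 : 0 < θ) (h1 : θ < 1 / 2)
    {x : ℤ} (hx : -(2 * N) ≤ x) (hx' : x ≤ 2 * N) :
    h N - h N / growthRate θ ^ N * wellPotential N θ x ≤ h x := by
  have hH : 0 ≤ h N := hh.nonneg h0 (by linarith) (by omega) (by omega)
  have hρ : 0 < growthRate θ ^ N := pow_pos (growthRate_pos h1) N
  have hK : 0 ≤ h N / growthRate θ ^ N := div_nonneg hH hρ.le
  rw [sub_eq_add_neg, ← neg_mul]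
  refine le_of_drift_le_of_ne (N := N)
    (f := fun y => h N + -(h N / growthRate θ ^ N) * wellPotential N θ y) h0 (by linarith)
    ?_ ?_ ?_ (fun y hy hy' hyN => ?_) hx hx'
  · rw [wellPotential_left, hh.left, neg_mul, div_mul_cancel₀ _ hρ.ne', add_neg_cancel]
  · rw [wellPotential_self]
    linarith
  · rw [wellPotential_right, hh.right, neg_mul, div_mul_cancel₀ _ hρ.ne', add_neg_cancel]
  · have h_avg : avg N θ (wellPotential N θ) y ≤ wellPotential N θ y :=
      (avg_wellPotential_le h0 h1 hy hyN).trans (mul_le_of_le_one_left (wellPotential_nonneg h1 y)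
        (by linarith [decayRate_pos h1]))
    rw [hh.drift hy hy', avg_affine]
    linarith [mul_le_mul_of_nonneg_left h_avg hK]

theorem IsMeanTime.growthRate_pow_sub_one_le (hh : IsMeanTime N θ h) (h0 : 0 < θ)
    (h1 : θ < 1 / 2) : growthRate θ ^ N - 1 ≤ h N := by
  have h_gap : 0 < 1 - 2 * θ := by linarith
  have h_le : (1 - 2 * θ)⁻¹ * growthRate θ ^ N + -(1 - 2 * θ)⁻¹ * wellPotential N θ N ≤ h N := by
    refine le_of_drift_le (N := N)
      (f := fun y => (1 - 2 * θ)⁻¹ * growthRate θ ^ N + -(1 - 2 * θ)⁻¹ * wellPotential N θ y)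
      h0 (by linarith) ?_ ?_ (fun y hy hy' => ?_)
      (by omega : -(2 * N : ℤ) ≤ N) (by omega : (N : ℤ) ≤ 2 * N)
    · rw [wellPotential_left, hh.left, neg_mul, add_neg_cancel]
    · rw [wellPotential_right, hh.right, neg_mul, add_neg_cancel]
    · have h_avg : avg N θ (wellPotential N θ) y - wellPotential N θ y ≤ 1 - 2 * θ := by
        rcases eq_or_ne y N with rfl | hyN
        · rw [avg_wellPotential_self, wellPotential_self, growthRate]
          linarith
        · linarith [avg_wellPotential_le h0 h1 hy hyN,
            mul_nonneg (decayRate_pos h1).le (wellPotential_nonneg (N := N) h1 y)]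
      rw [hh.drift hy hy', avg_affine]
      calc _ = (1 - 2 * θ)⁻¹ * (avg N θ (wellPotential N θ) y - wellPotential N θ y) := by ring
        _ ≤ (1 - 2 * θ)⁻¹ * (1 - 2 * θ) := by gcongr
        _ = 1 := inv_mul_cancel₀ h_gap.ne'
  rw [wellPotential_self] at h_le
  have h_one_le : 1 ≤ growthRate θ ^ N := one_le_pow₀ (one_lt_growthRate h1).le
  calc growthRate θ ^ N - 1 ≤ (1 - 2 * θ)⁻¹ * (growthRate θ ^ N - 1) :=
        le_mul_of_one_le_left (sub_nonneg.2 h_one_le) ((one_le_inv₀ h_gap).2 (by linarith))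
    _ ≤ h N := by linarith

theorem IsMeanTime.sub_saddlePotential_le (hh : IsMeanTime N θ h) (h0 : 0 < θ) (h1 : θ < 1 / 2)
    {x : ℤ} (hx : -(2 * N) ≤ x) (hxN : x ≤ N) : h N - h N * saddlePotential N θ x ≤ h x := by
  have hH : 0 ≤ h N := hh.nonneg h0 (by linarith) (by omega) (by omega)
  rw [sub_eq_add_neg, ← neg_mul]
  refine le_of_drift_le (N := N) (f := fun y => h N + -h N * saddlePotential N θ y) h0
    (by linarith) ?_ ?_ (fun y hy hyN => ?_) hx hxN
  · rw [saddlePotential_left, hh.left, mul_one, add_neg_cancel]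
  · linarith [mul_nonneg hH (saddlePotential_nonneg (N := N) h1 N)]
  · rw [hh.drift hy (by omega), avg_affine]
    linarith [mul_le_mul_of_nonneg_left (avg_saddlePotential_le h1 hyN) hH]

theorem IsMeanTime.sub_div_le_zero (hh : IsMeanTime N θ h) (h0 : 0 < θ) (h1 : θ < 1 / 2) :
    h N - h N / growthRate θ ^ N ≤ h 0 := by
  have := hh.sub_saddlePotential_le h0 h1 (by omega : -(2 * N : ℤ) ≤ 0) (by omega : (0 : ℤ) ≤ N)
  rw [saddlePotential_zero] at this
  linarith [div_eq_mul_inv (h N) (growthRate θ ^ N)]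

theorem IsMeanTime.abs_sub_zero_le (hh : IsMeanTime N θ h) (h0 : 0 < θ) (h1 : θ < 1 / 2) {x : ℤ}
    (hx : -(2 * N) ≤ x) (hx' : x ≤ 2 * N) :
    |h x - h 0| ≤ h N / growthRate θ ^ N * wellPotential N θ x +
      (h N / growthRate θ ^ N + 2 * N / (1 - 2 * θ)) := by
  have h_gap : 0 < 1 - 2 * θ := by linarith
  have hK : 0 ≤ h N / growthRate θ ^ N :=
    div_nonneg (hh.nonneg h0 (by linarith) (by omega) (by omega))
      (pow_nonneg (growthRate_pos h1).le N)
  have h_upper (y : ℤ) (hy : -(2 * N) ≤ y) (hy' : y ≤ 2 * N) :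
      h y ≤ h N + 2 * N / (1 - 2 * θ) := by
    refine (hh.le_add_wellDist h0 h1 hy hy').trans ?_
    rw [div_eq_inv_mul]
    gcongr
    exact_mod_cast wellDist_le hy hy'
  have hKV := mul_nonneg hK (wellPotential_nonneg (N := N) h1 x)
  refine abs_sub_le_iff.2 ⟨?_, ?_⟩
  · linarith [h_upper x hx hx', hh.sub_div_le_zero h0 h1]
  · linarith [h_upper 0 (by omega) (by omega), hh.sub_wellPotential_le h0 h1 hx hx']

/-- The corrector `(K / c) V + (2 K / c + K + D) h`, where `V` is the potential of the wells, `c`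
its decay rate, and `K V + K + D` the bound on `|h - h 0|` in `IsMeanTime.abs_sub_zero_le`. -/
noncomputable def corrector (N : ℕ) (θ : ℝ) (h : ℤ → ℝ) (x : ℤ) : ℝ :=
  h N / growthRate θ ^ N / decayRate θ * wellPotential N θ x +
    (2 * (h N / growthRate θ ^ N) / decayRate θ + h N / growthRate θ ^ N +
      2 * N / (1 - 2 * θ)) * h x

theorem IsMeanTime.isCorrector (hh : IsMeanTime N θ h) (h0 : 0 < θ) (h1 : θ < 1 / 2) :
    IsCorrector N θ h (corrector N θ h) := by
  have hD : 0 ≤ 2 * N / (1 - 2 * θ) := div_nonneg (by positivity) (by linarith)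
  have hc := decayRate_pos h1
  have hK : 0 ≤ h N / growthRate θ ^ N :=
    div_nonneg (hh.nonneg h0 (by linarith) (by omega) (by omega))
      (pow_nonneg (growthRate_pos h1).le N)
  refine ⟨fun x hx hx' => ?_, fun x hx hx' => ?_⟩
  · have := wellPotential_nonneg (N := N) h1 x
    have := hh.nonneg h0 (by linarith) hx hx'
    unfold corrector
    positivity
  · have h_avg : avg N θ (corrector N θ h) x =
        h N / growthRate θ ^ N / decayRate θ * avg N θ (wellPotential N θ) x +
          (2 * (h N / growthRate θ ^ N) / decayRate θ + h N / growthRate θ ^ N +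
            2 * N / (1 - 2 * θ)) * avg N θ h x := by
      unfold corrector avg
      ring
    have h_dev := hh.abs_sub_zero_le h0 h1 hx.le hx'.le
    have h_drift := hh.drift hx hx'
    rw [h_avg, corrector]
    set K := h N / growthRate θ ^ N
    have h_potential := mul_le_mul_of_nonneg_left
      (decayRate_mul_wellPotential_add_avg_le h0 h1 hx) (div_nonneg hK hc.le)
    have h_cancel : K / decayRate θ *
        (decayRate θ * wellPotential N θ x + avg N θ (wellPotential N θ) x) =
        K * wellPotential N θ x + K / decayRate θ * avg N θ (wellPotential N θ) x := by
      field_simp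
    linear_combination h_dev + h_potential - h_cancel -
      (2 * K / decayRate θ + K + 2 * N / (1 - 2 * θ)) * h_drift

theorem IsMeanTime.le_two_mul_zero (hh : IsMeanTime N θ h) (h0 : 0 < θ) (h1 : θ < 1 / 2)
    (hN : 2 ≤ growthRate θ ^ N) : h N ≤ 2 * h 0 := by
  have hH : 0 ≤ h N := hh.nonneg h0 (by linarith) (by omega) (by omega)
  linarith [hh.sub_div_le_zero h0 h1, div_le_div_of_nonneg_left hH two_pos hN]

theorem IsMeanTime.growthRate_pow_div_le_zero (hh : IsMeanTime N θ h) (h0 : 0 < θ)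
    (h1 : θ < 1 / 2) (hN : 2 ≤ growthRate θ ^ N) : growthRate θ ^ N / 4 ≤ h 0 := by
  linarith [hh.growthRate_pow_sub_one_le h0 h1, hh.le_two_mul_zero h0 h1 hN]

theorem IsMeanTime.corrector_zero_div_le (hh : IsMeanTime N θ h) (h0 : 0 < θ) (h1 : θ < 1 / 2)
    (hN : 2 ≤ growthRate θ ^ N) :
    corrector N θ h 0 / h 0 ^ 2 ≤
      (12 / decayRate θ + 2 + 8 * N / (1 - 2 * θ)) / growthRate θ ^ N := by
  have h_gap : 0 < 1 - 2 * θ := by linarith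
  have hc := decayRate_pos h1
  have hH := hh.le_two_mul_zero h0 h1 hN
  have h_zero := hh.growthRate_pow_div_le_zero h0 h1 hN
  rw [corrector, wellPotential_zero]
  set r := growthRate θ ^ N
  set c := decayRate θ
  have : 0 < r := by linarith
  have h_pos : 0 < h 0 := by linarith
  have h_inv : (h 0)⁻¹ ≤ 4 / r := by
    rw [inv_le_comm₀ h_pos (by positivity), inv_div]
    exact h_zero
  have h_ratio : h N / h 0 ≤ 2 := (div_le_iff₀ h_pos).2 hH
  calc (h N / r / c * r + (2 * (h N / r) / c + h N / r + 2 * N / (1 - 2 * θ)) * h 0) / h 0 ^ 2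
      = h N / h 0 * (1 / c) * (h 0)⁻¹ + h N / h 0 * ((2 / c + 1) / r) +
          2 * N / (1 - 2 * θ) * (h 0)⁻¹ := by
        field_simp
        ring
    _ ≤ 2 * (1 / c) * (4 / r) + 2 * ((2 / c + 1) / r) + 2 * N / (1 - 2 * θ) * (4 / r) := by
        gcongr
    _ = (12 / c + 2 + 8 * N / (1 - 2 * θ)) / r := by
        field_simp
        ring

end Bounds

section Asymptotics

variable {θ : ℝ}

theorem tendsto_growthRate_pow_atTop (h1 : θ < 1 / 2) :
    Tendsto (fun N : ℕ => growthRate θ ^ N) atTop atTop :=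
  tendsto_pow_atTop_atTop_of_one_lt (one_lt_growthRate h1)

theorem tendsto_affine_div_growthRate_pow (h1 : θ < 1 / 2) (a b : ℝ) :
    Tendsto (fun N : ℕ => (a + b * N) / growthRate θ ^ N) atTop (𝓝 0) := by
  have h_inv := inv_lt_one_of_one_lt₀ (one_lt_growthRate h1)
  have h_nonneg := inv_nonneg.2 (growthRate_pos h1).le
  have h_lim := ((tendsto_pow_atTop_nhds_zero_of_lt_one h_nonneg h_inv).const_mul a).add
    ((tendsto_self_mul_const_pow_of_lt_one h_nonneg h_inv).const_mul b)
  rw [mul_zero, mul_zero, add_zero] at h_lim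
  refine h_lim.congr fun N => ?_
  rw [inv_pow]
  ring

theorem exists_isCorrector_of_lt_half (h0 : 0 < θ) (h1 : θ < 1 / 2) :
    ∃ h W : ℕ → ℤ → ℝ, (∀ N, IsMeanTime N θ (h N)) ∧ (∀ N, IsCorrector N θ (h N) (W N)) ∧
      Tendsto (fun N => h N 0) atTop atTop ∧
      Tendsto (fun N => W N 0 / h N 0 ^ 2) atTop (𝓝 0) := by
  choose h hh using fun N : ℕ => exists_isMeanTime N h0 (by linarith : θ < 1)
  have hW (N : ℕ) : IsCorrector N θ (h N) (corrector N θ (h N)) := (hh N).isCorrector h0 h1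
  have h_large := (tendsto_growthRate_pow_atTop h1).eventually_ge_atTop 2
  refine ⟨h, fun N => corrector N θ (h N), hh, hW, ?_, ?_⟩
  · refine tendsto_atTop_mono' atTop ?_
      ((tendsto_growthRate_pow_atTop h1).atTop_div_const (by norm_num : (0 : ℝ) < 4))
    exact h_large.mono fun N hN => (hh N).growthRate_pow_div_le_zero h0 h1 hN
  · refine squeeze_zero' (.of_forall fun N => ?_)
      (h_large.mono fun N hN => (hh N).corrector_zero_div_le h0 h1 hN) ?_
    · exact div_nonneg ((hW N).nonneg 0 (by omega) (by omega)) (sq_nonneg _)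
    · refine (tendsto_affine_div_growthRate_pow h1 (12 / decayRate θ + 2)
        (8 / (1 - 2 * θ))).congr fun N => ?_
      rw [div_mul_eq_mul_div]

theorem exists_isCorrector (h0 : 0 < θ) (h1 : θ < 1) (h_half : θ ≠ 1 / 2) :
    ∃ h W : ℕ → ℤ → ℝ, (∀ N, IsMeanTime N θ (h N)) ∧ (∀ N, IsCorrector N θ (h N) (W N)) ∧
      Tendsto (fun N => h N 0) atTop atTop ∧
      Tendsto (fun N => W N 0 / h N 0 ^ 2) atTop (𝓝 0) := by
  rcases lt_or_gt_of_ne h_half with h_lt | h_gt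
  · exact exists_isCorrector_of_lt_half h0 h_lt
  · obtain ⟨h, W, hh, hW, hm, hWm⟩ :=
      exists_isCorrector_of_lt_half (θ := 1 - θ) (by linarith) (by linarith)
    exact ⟨fun N x => h N (-x), fun N x => W N (-x), fun N => (hh N).comp_neg,
      fun N => (hW N).comp_neg, by simpa using hm, by simpa using hWm⟩

end Asymptotics

end AltWells

theorem mainTheorem6 (θ : unitInterval) (hθ0 : θ ≠ 0) (hθ1 : θ ≠ 1) (hθ : (θ : ℝ) ≠ 1 / 2)
    (B : (N : ℕ) → Matrix.rowStochastic ℝ (AltWells.State N)) :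
    (∀ N : ℕ, (∀ᵐ ω ∂(AltWells.law N θ (B N)), AltWells.τ N ω ≠ ⊤) ∧
      AltWells.mean N θ (B N) ≠ ⊤) ∧
    TendstoInDistribution
      (fun (N : ℕ) (ω : ℕ → AltWells.State N) =>
        ((AltWells.τ N ω).toNat : ℝ) / (AltWells.mean N θ (B N)).toReal)
      atTop (id : ℝ → ℝ) (fun N => AltWells.law N θ (B N)) (expMeasure 1) := by
  have h0 : (0 : ℝ) < θ := unitInterval.pos_iff_ne_zero.2 hθ0
  have h1 : (θ : ℝ) < 1 := unitInterval.lt_one_iff_ne_one.2 hθ1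
  obtain ⟨h, W, hh, hW, hm, hWm⟩ := AltWells.exists_isCorrector h0 h1 hθ
  have hh' (N : ℕ) := (hh N).isMeanHittingTime h0 h1 (B N)
  have h_mean (N : ℕ) : AltWells.mean N θ (B N) = ENNReal.ofReal (h N 0) :=
    (hh' N).lintegral_hittingTime
  have h_toReal (N : ℕ) : (AltWells.mean N θ (B N)).toReal = h N 0 := by
    rw [h_mean]
    exact ENNReal.toReal_ofReal ((hh' N).nonneg (AltWells.origin N))
  refine ⟨fun N => ⟨(hh' N).ae_hittingTime_ne_top, h_mean N ▸ ENNReal.ofReal_ne_top⟩, ?_⟩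
  simp_rw [h_toReal]
  exact Markov.tendstoInDistribution_hittingTime hh' (fun N => (hW N).isCorrector (B N)) hm hWm
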